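/- Let $a_k=2^k+1$ for $k\ge1$, and consider $S_n(\omega)=\sum_{k=1}^n\cos(2\pi a_k\omega)$, $\omega\in[0,1]$, as a random variable on $[0,1]$ with Lebesgue measure. For a real random variable $X$ whose moment generating function is finite on $\mathbb{R}$, let $\kappa_m(X)=\frac{d^m}{dt^m}\log\mathbb{E}[e^{tX}]\big|_{t=0}$, $m\ge1$, denote its $m$-th cumulant. Then $\kappa_m(S_n)=0$ for every odd $m$ and every $n\ge1$, and $$\kappa_2(S_n)=\frac n2\quad(n\ge1),\qquad \kappa_4(S_n)=\frac{-3n+28}{8}\quad(n\ge4),\qquad \kappa_6(S_n)=\frac{45n^2+380n-1875}{16}\quad(n\ge7).$$ In particular, the sixth cumulant grows quadratically, $\kappa_6(S_n)/n^2\to 45/16$ as $n\to\infty$, whereas for the independent model $\widetilde S_n=\sum_{k=1}^n\cos(2\pi a_kU_k)$, with $U_1,U_2,\dots$ independent and uniformly distributed on $[0,1]$, the sixth cumulant is linear: $\kappa_6(\widetilde S_n)=\frac54 n$ for all $n$. -/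

import Mathlib

open MeasureTheory ProbabilityTheory Filter Topology

noncomputable section

/-- The `m`-th cumulant of a real random variable `X` on `(Ω, μ)`:
the `m`-th derivative at `0` of `t ↦ log 𝔼[exp (t X)]`. -/
def cumulant {Ω : Type*} [MeasurableSpace Ω] (m : ℕ) (X : Ω → ℝ) (μ : Measure Ω) : ℝ :=
  iteratedDeriv m (cgf X μ) 0

/-- Lebesgue measure on `[0,1]`, as a Borel measure on `ℝ`. -/
def unifMeasure : Measure ℝ := volume.restrict (Set.Icc (0 : ℝ) 1)

/-- The lacunary trigonometric sum `S_n(ω) = ∑_{k=1}^n cos (2 π a_k ω)`. -/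
def lacunarySum (a : ℕ → ℕ) (n : ℕ) (ω : ℝ) : ℝ :=
  ∑ k ∈ Finset.Icc 1 n, Real.cos (2 * Real.pi * (a k : ℝ) * ω)

/-- The independent model `∑_{k=1}^n cos (2 π a_k U_k)`. -/
def independentSum {Ω : Type*} (a : ℕ → ℕ) (U : ℕ → Ω → ℝ) (n : ℕ) (ω : Ω) : ℝ :=
  ∑ k ∈ Finset.Icc 1 n, Real.cos (2 * Real.pi * (a k : ℝ) * U k ω)

/-- The sequence `a_k = 2^k + 1`. -/
def shiftedPow (k : ℕ) : ℕ := 2 ^ k + 1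

instance unifMeasure_isProbabilityMeasure : IsProbabilityMeasure unifMeasure :=
  ⟨by simp [unifMeasure]⟩

/-- The moment generating function of the lacunary sum is finite everywhere. -/
theorem lacunarySum_integrable_exp (a : ℕ → ℕ) (n : ℕ) (t : ℝ) :
    Integrable (fun ω => Real.exp (t * lacunarySum a n ω)) unifMeasure := by
  have hc : Continuous (fun ω => Real.exp (t * lacunarySum a n ω)) := by
    unfold lacunarySum
    fun_prop
  exact (hc.continuousOn.integrableOn_compact isCompact_Icc)

/-- Hence its cumulant generating function is analytic, so that all the derivatives in the
definition of the cumulants exist. -/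
theorem lacunarySum_analyticAt_cgf (a : ℕ → ℕ) (n : ℕ) :
    AnalyticAt ℝ (cgf (lacunarySum a n) unifMeasure) 0 := by
  apply analyticAt_cgf
  have h : integrableExpSet (lacunarySum a n) unifMeasure = Set.univ :=
    Set.eq_univ_of_forall (lacunarySum_integrable_exp a n)
  simp [h]

end

/-! Writing each cosine with exponentials, the `p`-th moment of `2 * S_n` counts signed relations of
length `p` among the `2 ^ k + 1`. With `a` plus signs these say `∑ 2 ^ x i - ∑ 2 ^ y i = (p - a) -
a`. Splitting off the summands `2` and halving the rest gives a linear recursion in `n` whose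
coefficients do not depend on `n` (`integral_charZ_mul_charSum_pow`). A finite box of parameters is
stable under it, so a fourth difference that vanishes on the box at `n = 7` vanishes for all `n ≥ 7`
(`signedPowCount_difference`). Moments of order at most `6` are then cubic in `n`, fixed by four
computed values. All `a_k` are odd, so `ω ↦ ω + 1/2` flips the sign of `S_n`; odd cumulants vanish
and the even ones follow from the moment-cumulant recursion. Behind the quadratic growth, though not
used in the proof, is `2 * a_k - a_(k+1) = 1 = 2 * a_l - a_(l+1)`: a six-term relation with two free
indices. -/

/-! ### Counting signed sums of powers of two -/

/-- One step of the recursion for `signedPowCount`: the summands equal to `2` are split off and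
the remaining ones are halved. -/
def signedPowStep (g : ℕ → ℕ → ℤ → ℕ) (a b : ℕ) (c : ℤ) : ℕ :=
  if c % 2 = 0 then
    ∑ j ∈ Finset.range (a + 1), ∑ k ∈ Finset.range (b + 1),
      a.choose j * b.choose k * g (a - j) (b - k) (c / 2 - j + k)
  else 0

/-- The number of `(x, y) ∈ [1, n] ^ a × [1, n] ^ b` with `∑ 2 ^ x i - ∑ 2 ^ y i = c`,
computed recursively in `n`. -/
def signedPowCount : ℕ → ℕ → ℕ → ℤ → ℕ
  | 0 => fun a b c => if a = 0 ∧ b = 0 ∧ c = 0 then 1 else 0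
  | n + 1 => signedPowStep (signedPowCount n)

/-- The values of `g` on the box `a, b ≤ 6`, `|c| ≤ 12`, `c` even. -/
def tabulateCount (g : ℕ → ℕ → ℤ → ℕ) : List (List (List ℕ)) :=
  (List.range 7).map fun a => (List.range 7).map fun b => (List.range 13).map fun (i : ℕ) =>
    g a b (2 * ((i : ℤ) - 6))

/-- The function tabulated by `tabulateCount`, extended by zero. -/
def lookupCount (t : List (List (List ℕ))) (a b : ℕ) (c : ℤ) : ℕ :=
  if c % 2 = 0 then ((t.getD a []).getD b []).getD (c / 2 + 6).toNat 0 else 0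

/-- The table of `signedPowCount n`, computed by dynamic programming. -/
def countTable : ℕ → List (List (List ℕ))
  | 0 => tabulateCount (signedPowCount 0)
  | n + 1 => tabulateCount (signedPowStep (lookupCount (countTable n)))

theorem lookupCount_tabulateCount (g : ℕ → ℕ → ℤ → ℕ) {a b : ℕ} {c : ℤ} (ha : a < 7)
    (hb : b < 7) (hc : |c| ≤ 12) (h2 : c % 2 = 0) :
    lookupCount (tabulateCount g) a b c = g a b c := by
  rw [abs_le] at hc
  have hi : (c / 2 + 6).toNat < 13 := by omega
  have hci : 2 * (((c / 2 + 6).toNat : ℤ) - 6) = c := by omega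
  simp [lookupCount, tabulateCount, h2, List.getD_eq_getElem?_getD, ha, hb, hi]
  rw [max_eq_left (by omega), show 2 * (c / 2 + 6 - 6) = c by omega]

theorem signedPowCount_of_odd (n a b : ℕ) {c : ℤ} (h2 : c % 2 ≠ 0) :
    signedPowCount n a b c = 0 := by
  cases n with
  | zero =>
    have : c ≠ 0 := by rintro rfl; simp at h2
    simp [signedPowCount, this]
  | succ n => simp [signedPowCount, signedPowStep, h2]

/-- The region is stable: removing `j + k` summands lowers `a + b` by `j + k`, while the new target
is at most `|c| / 2 + j + k` in absolute value. -/
theorem signedPowStep_congr {g g' : ℕ → ℕ → ℤ → ℕ}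
    (h : ∀ (a b : ℕ) (c : ℤ), a + b ≤ 6 → (a : ℤ) + b + |c| ≤ 12 → g a b c = g' a b c)
    {a b : ℕ} {c : ℤ} (hab : a + b ≤ 6) (hc : (a : ℤ) + b + |c| ≤ 12) :
    signedPowStep g a b c = signedPowStep g' a b c := by
  unfold signedPowStep
  split_ifs with h2
  · refine Finset.sum_congr rfl fun j hj => Finset.sum_congr rfl fun k hk => ?_
    rw [Finset.mem_range] at hj hk
    have h1 : |c / 2 - j + k| ≤ |c| / 2 + j + k := by
      rw [abs_le]; rcases abs_cases c with h | h <;> omega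
    rw [h _ _ _ (by omega) (by omega)]
  · rfl

theorem lookupCount_countTable (n : ℕ) : ∀ (a b : ℕ) (c : ℤ), a + b ≤ 6 → (a : ℤ) + b + |c| ≤ 12 →
    lookupCount (countTable n) a b c = signedPowCount n a b c := by
  induction n with
  | zero =>
    intro a b c hab hc
    have hp := abs_nonneg c
    by_cases h2 : c % 2 = 0
    · exact lookupCount_tabulateCount _ (by omega) (by omega) (by omega) h2
    · rw [signedPowCount_of_odd _ _ _ h2, lookupCount, if_neg h2]
  | succ n ih =>
    intro a b c hab hc
    have hp := abs_nonneg c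
    by_cases h2 : c % 2 = 0
    · rw [countTable, lookupCount_tabulateCount _ (by omega) (by omega) (by omega) h2,
        signedPowStep_congr ih hab hc, signedPowCount]
    · rw [signedPowCount_of_odd _ _ _ h2, lookupCount, if_neg h2]

/-- The fourth finite difference in `n` vanishes at `n = 7`, by evaluation. -/
theorem countTable_difference : ∀ a < (7 : ℕ), ∀ b < (7 : ℕ) - a, ∀ i < (13 : ℕ),
    (a : ℤ) + b + |2 * ((i : ℤ) - 6)| ≤ 12 →
      lookupCount (countTable 11) a b (2 * ((i : ℤ) - 6)) +
          6 * lookupCount (countTable 9) a b (2 * ((i : ℤ) - 6)) +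
          lookupCount (countTable 7) a b (2 * ((i : ℤ) - 6)) =
        4 * lookupCount (countTable 10) a b (2 * ((i : ℤ) - 6)) +
          4 * lookupCount (countTable 8) a b (2 * ((i : ℤ) - 6)) := by
  decide +kernel

/-- The fourth difference, with negative terms moved across to stay in `ℕ`, obeys the same linear
recursion as the counts, so its vanishing propagates from `n = 7`. -/
theorem signedPowCount_difference {n : ℕ} (hn : 7 ≤ n) : ∀ (a b : ℕ) (c : ℤ), a + b ≤ 6 →
    (a : ℤ) + b + |c| ≤ 12 →
    signedPowCount (n + 4) a b c + 6 * signedPowCount (n + 2) a b c + signedPowCount n a b c =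
      4 * signedPowCount (n + 3) a b c + 4 * signedPowCount (n + 1) a b c := by
  induction n, hn using Nat.le_induction with
  | base =>
    intro a b c hab hc
    by_cases h2 : c % 2 = 0
    · have hp := abs_le.1 (show |c| ≤ 12 by omega)
      have h := countTable_difference a (by omega) b (by omega) (c / 2 + 6).toNat (by omega)
      rw [show 2 * (((c / 2 + 6).toNat : ℤ) - 6) = c by omega] at h
      simpa only [lookupCount_countTable _ a b c hab hc] using h hc
    · simp [signedPowCount_of_odd _ _ _ h2]
  | succ n hn ih =>
    intro a b c hab hc
    change signedPowStep (signedPowCount (n + 4)) a b c +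
        6 * signedPowStep (signedPowCount (n + 2)) a b c + signedPowStep (signedPowCount n) a b c =
      4 * signedPowStep (signedPowCount (n + 3)) a b c +
        4 * signedPowStep (signedPowCount (n + 1)) a b c
    simp only [signedPowStep]
    split_ifs with h2
    · simp only [Finset.mul_sum, ← Finset.sum_add_distrib]
      refine Finset.sum_congr rfl fun j hj => Finset.sum_congr rfl fun k hk => ?_
      rw [Finset.mem_range] at hj hk
      have h1 : |c / 2 - j + k| ≤ |c| / 2 + j + k := by
        rw [abs_le]; rcases abs_cases c with h | h <;> omega
      have h := ih (a - j) (b - k) (c / 2 - j + k) (by omega) (by omega)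
      linear_combination a.choose j * b.choose k * h
    · simp

/-! ### Moments as polynomials in `n` -/

/-- The constant coefficient of `(∑ k ∈ [1, n], (z ^ (2 ^ k + 1) + z ^ (-2 ^ k - 1))) ^ p`. -/
def signedPowMoment (p n : ℕ) : ℕ :=
  ∑ a ∈ Finset.range (p + 1), p.choose a * signedPowCount n a (p - a) ((p - a : ℕ) - a)

theorem signedPowMoment_eq_lookupCount {p : ℕ} (hp : p ≤ 6) (n : ℕ) :
    signedPowMoment p n = ∑ a ∈ Finset.range (p + 1),
      p.choose a * lookupCount (countTable n) a (p - a) ((p - a : ℕ) - a) := by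
  refine Finset.sum_congr rfl fun a ha => ?_
  rw [Finset.mem_range] at ha
  -- Here `|(p - a) - a| ≤ p ≤ 6`, so order plus target stays within `12`.
  rw [lookupCount_countTable _ _ _ _ (by omega)]
  rcases abs_cases (((p - a : ℕ) : ℤ) - a) with h | h <;> omega

theorem signedPowMoment_difference {p n : ℕ} (hp : p ≤ 6) (hn : 7 ≤ n) :
    signedPowMoment p (n + 4) + 6 * signedPowMoment p (n + 2) + signedPowMoment p n =
      4 * signedPowMoment p (n + 3) + 4 * signedPowMoment p (n + 1) := by
  simp only [signedPowMoment, Finset.mul_sum, ← Finset.sum_add_distrib]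
  refine Finset.sum_congr rfl fun a ha => ?_
  rw [Finset.mem_range] at ha
  have h := signedPowCount_difference hn a (p - a) ((p - a : ℕ) - a) (by omega)
    (by rcases abs_cases (((p - a : ℕ) : ℤ) - a) with h | h <;> omega)
  linear_combination p.choose a * h

theorem signedPowMoment_eq_of_difference {p : ℕ} (hp : p ≤ 6) {f : ℕ → ℤ}
    (hf : ∀ n, f (n + 4) + 6 * f (n + 2) + f n = 4 * f (n + 3) + 4 * f (n + 1))
    (h7 : signedPowMoment p 7 = f 7) (h8 : signedPowMoment p 8 = f 8)
    (h9 : signedPowMoment p 9 = f 9) (h10 : signedPowMoment p 10 = f 10) {n : ℕ} (hn : 7 ≤ n) :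
    (signedPowMoment p n : ℤ) = f n := by
  suffices h : (signedPowMoment p n : ℤ) = f n ∧ (signedPowMoment p (n + 1) : ℤ) = f (n + 1) ∧
      (signedPowMoment p (n + 2) : ℤ) = f (n + 2) ∧
      (signedPowMoment p (n + 3) : ℤ) = f (n + 3) from h.1
  induction n, hn using Nat.le_induction with
  | base => exact ⟨h7, h8, h9, h10⟩
  | succ n hn ih =>
    have h := signedPowMoment_difference hp hn
    have h' := hf n
    obtain ⟨i1, i2, i3, i4⟩ := ih
    refine ⟨i2, i3, i4, ?_⟩
    change (signedPowMoment p (n + 4) : ℤ) = f (n + 4)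
    omega

theorem signedPowMoment_two {n : ℕ} (hn : 1 ≤ n) : (signedPowMoment 2 n : ℤ) = 2 * n := by
  have h : ∀ n ∈ Finset.Icc 1 10, (signedPowMoment 2 n : ℤ) = 2 * n := by
    simp only [signedPowMoment_eq_lookupCount (show 2 ≤ 6 by norm_num)]
    decide +kernel
  rcases lt_or_ge n 7 with h7 | h7
  · exact h n (by simp; omega)
  · exact signedPowMoment_eq_of_difference (f := fun n => 2 * n) (by norm_num)
      (fun n => by push_cast; ring) (h 7 (by simp)) (h 8 (by simp)) (h 9 (by simp))
      (h 10 (by simp)) h7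

theorem signedPowMoment_four {n : ℕ} (hn : 4 ≤ n) :
    (signedPowMoment 4 n : ℤ) = 12 * n ^ 2 - 6 * n + 56 := by
  have h : ∀ n ∈ Finset.Icc 4 10, (signedPowMoment 4 n : ℤ) = 12 * n ^ 2 - 6 * n + 56 := by
    simp only [signedPowMoment_eq_lookupCount (show 4 ≤ 6 by norm_num)]
    decide +kernel
  rcases lt_or_ge n 7 with h7 | h7
  · exact h n (by simp; omega)
  · exact signedPowMoment_eq_of_difference (f := fun n => 12 * n ^ 2 - 6 * n + 56) (by norm_num)
      (fun n => by push_cast; ring) (h 7 (by simp)) (h 8 (by simp)) (h 9 (by simp))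
      (h 10 (by simp)) h7

theorem signedPowMoment_six {n : ℕ} (hn : 7 ≤ n) :
    (signedPowMoment 6 n : ℤ) = 120 * n ^ 3 + 3200 * n - 7500 := by
  have h : ∀ n ∈ Finset.Icc 7 10,
      (signedPowMoment 6 n : ℤ) = 120 * n ^ 3 + 3200 * n - 7500 := by
    simp only [signedPowMoment_eq_lookupCount (show 6 ≤ 6 by norm_num)]
    decide +kernel
  exact signedPowMoment_eq_of_difference (f := fun n => 120 * n ^ 3 + 3200 * n - 7500)
    (by norm_num) (fun n => by push_cast; ring) (h 7 (by simp)) (h 8 (by simp)) (h 9 (by simp))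
    (h 10 (by simp)) hn

theorem signedPowMoment_four_one : signedPowMoment 4 1 = 6 := by
  rw [signedPowMoment_eq_lookupCount (by norm_num)]
  decide +kernel

theorem signedPowMoment_six_one : signedPowMoment 6 1 = 20 := by
  rw [signedPowMoment_eq_lookupCount (by norm_num)]
  decide +kernel

/-! ### Moments as Fourier integrals -/

/-- The character `ω ↦ exp (2 π i m ω)` of period `1`. -/
noncomputable def charZ (m : ℤ) (ω : ℝ) : ℂ := Complex.exp (2 * Real.pi * Complex.I * m * ω)

theorem charZ_add (m k : ℤ) (ω : ℝ) : charZ (m + k) ω = charZ m ω * charZ k ω := by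
  rw [charZ, charZ, charZ, ← Complex.exp_add]
  push_cast
  ring_nf

theorem charZ_pow (m : ℤ) (j : ℕ) (ω : ℝ) : charZ m ω ^ j = charZ (j * m) ω := by
  rw [charZ, charZ, ← Complex.exp_nat_mul]
  push_cast
  ring_nf

theorem charZ_two_mul (m : ℤ) (ω : ℝ) : charZ m (2 * ω) = charZ (2 * m) ω := by
  rw [charZ, charZ]
  push_cast
  ring_nf

theorem charZ_two_mul_add_half (m : ℤ) (ω : ℝ) : charZ (2 * m) (ω + 1 / 2) = charZ (2 * m) ω := by
  rw [charZ, charZ, Complex.exp_eq_exp_iff_exists_int]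
  exact ⟨m, by push_cast; ring⟩

theorem charZ_odd_add_half (m : ℤ) (ω : ℝ) :
    charZ (2 * m + 1) (ω + 1 / 2) = -charZ (2 * m + 1) ω := by
  rw [charZ_add, charZ_add, charZ_two_mul_add_half]
  have : charZ 1 (ω + 1 / 2) = -charZ 1 ω := by
    rw [charZ, charZ, ← mul_neg_one (Complex.exp _), ← Complex.exp_pi_mul_I, ← Complex.exp_add]
    push_cast
    ring_nf
  rw [this, mul_neg]

theorem charZ_add_one (m : ℤ) (ω : ℝ) : charZ m (ω + 1) = charZ m ω := by
  rw [charZ, charZ, Complex.exp_eq_exp_iff_exists_int]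
  exact ⟨m, by push_cast; ring⟩

@[fun_prop]
theorem continuous_charZ (m : ℤ) : Continuous (charZ m) := by
  unfold charZ
  fun_prop

theorem integral_charZ (m : ℤ) : ∫ ω in (0 : ℝ)..1, charZ m ω = if m = 0 then 1 else 0 := by
  split_ifs with h
  · simp [h, charZ]
  · have hc : 2 * Real.pi * Complex.I * m ≠ 0 := by
      simp [h, Real.pi_ne_zero]
    have h1 : Complex.exp (2 * Real.pi * Complex.I * m) = 1 := by
      rw [Complex.exp_eq_one_iff]
      exact ⟨m, by ring⟩
    simp [charZ, integral_exp_mul_complex hc, h1]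

theorem charZ_add_charZ_neg (m : ℤ) (ω : ℝ) :
    charZ m ω + charZ (-m) ω = ((2 * Real.cos (2 * Real.pi * m * ω) : ℝ) : ℂ) := by
  push_cast
  rw [Complex.cos, charZ, charZ]
  push_cast
  ring_nf

/-- The sum `∑ k ∈ [1, n], exp (2 π i ε 2 ^ k ω)`. -/
noncomputable def charSum (ε : ℤ) (n : ℕ) (ω : ℝ) : ℂ := ∑ k ∈ Finset.Icc 1 n, charZ (2 ^ k * ε) ω

theorem charSum_succ (ε : ℤ) (n : ℕ) (ω : ℝ) :
    charSum ε (n + 1) ω = charZ (2 * ε) ω + charSum ε n (2 * ω) := by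
  simp only [charSum, charZ_two_mul]
  induction n with
  | zero => simp
  | succ n ih =>
    rw [Finset.sum_Icc_succ_top (by omega), ih, Finset.sum_Icc_succ_top (by omega), add_assoc,
      pow_succ' (2 : ℤ) (n + 1), mul_assoc]

theorem charSum_add_half (ε : ℤ) (n : ℕ) (ω : ℝ) :
    charSum ε n (ω + 1 / 2) = charSum ε n ω := by
  refine Finset.sum_congr rfl fun k hk => ?_
  obtain ⟨k, rfl⟩ := Nat.exists_eq_add_of_le (Finset.mem_Icc.1 hk).1
  rw [show (2 : ℤ) ^ (1 + k) * ε = 2 * (2 ^ k * ε) by ring, charZ_two_mul_add_half]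

theorem charSum_add_one (ε : ℤ) (n : ℕ) (ω : ℝ) : charSum ε n (ω + 1) = charSum ε n ω :=
  Finset.sum_congr rfl fun _ _ => charZ_add_one _ _

@[fun_prop]
theorem continuous_charSum (ε : ℤ) (n : ℕ) : Continuous (charSum ε n) :=
  continuous_finsetSum _ fun _ _ => continuous_charZ _

theorem integral_comp_natCast_mul_of_periodic {E : Type*} [NormedAddCommGroup E]
    [NormedSpace ℝ E] {f : ℝ → E} (hf : Continuous f)
    (hp : Function.Periodic f 1) {m : ℕ} (hm : m ≠ 0) :
    ∫ ω in (0 : ℝ)..1, f (m * ω) = ∫ ω in (0 : ℝ)..1, f ω := by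
  have hm' : (m : ℝ) ≠ 0 := Nat.cast_ne_zero.2 hm
  have h := hp.intervalIntegral_add_zsmul_eq m 0 fun _ _ => hf.intervalIntegrable _ _
  rw [intervalIntegral.integral_comp_mul_left f hm']
  simp only [zero_add, natCast_zsmul, nsmul_eq_mul, mul_one] at h
  rw [mul_zero, mul_one, h, ← Nat.cast_smul_eq_nsmul ℝ, smul_smul, inv_mul_cancel₀ hm', one_smul]

theorem integral_eq_zero_of_antiperiodic_half {f : ℝ → ℂ} (hf : Function.Antiperiodic f (1 / 2)) :
    ∫ ω in (0 : ℝ)..1, f ω = 0 := by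
  have hp : Function.Periodic f 1 := by
    have := hf.periodic_two_mul
    norm_num at this
    exact this
  have h : ∫ ω in (0 : ℝ)..1, f (ω + 1 / 2) = ∫ ω in (0 : ℝ)..1, f ω := by
    rw [intervalIntegral.integral_comp_add_right f, zero_add, add_comm (1 : ℝ),
      hp.intervalIntegral_add_eq (1 / 2) 0, zero_add]
  simp only [show ∀ ω, f (ω + 1 / 2) = -f ω from hf, intervalIntegral.integral_neg] at h
  exact self_eq_neg.1 h.symm

/-- The analytic form of the recursion: `charSum_succ` splits off the frequency `±2`, the rest is a
function of `2 * ω`, and doubling preserves the integral over a period. -/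
theorem integral_charZ_mul_charSum_pow (n : ℕ) : ∀ (a b : ℕ) (c : ℤ),
    ∫ ω in (0 : ℝ)..1, charZ (-c) ω * (charSum 1 n ω ^ a * charSum (-1) n ω ^ b) =
      signedPowCount n a b c := by
  induction n with
  | zero =>
    intro a b c
    by_cases ha : a = 0 <;> by_cases hb : b = 0 <;>
      simp [charSum, ha, hb, integral_charZ, signedPowCount]
  | succ n ih =>
    intro a b c
    change _ = ((signedPowStep (signedPowCount n) a b c : ℕ) : ℂ)
    rw [signedPowStep]
    split_ifs with h2
    · have hω : ∀ ω, charZ (-c) ω * (charSum 1 (n + 1) ω ^ a * charSum (-1) (n + 1) ω ^ b) =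
          ∑ j ∈ Finset.range (a + 1), ∑ k ∈ Finset.range (b + 1),
            (a.choose j * b.choose k : ℂ) * (charZ (-(c / 2 - j + k)) (2 * ω) *
              (charSum 1 n (2 * ω) ^ (a - j) * charSum (-1) n (2 * ω) ^ (b - k))) := by
        intro ω
        rw [charSum_succ, charSum_succ, add_pow, add_pow, Finset.sum_mul_sum, Finset.mul_sum]
        refine Finset.sum_congr rfl fun j _ => ?_
        rw [Finset.mul_sum]
        refine Finset.sum_congr rfl fun k _ => ?_
        rw [charZ_two_mul,
          show 2 * -(c / 2 - (j : ℤ) + k) = -c + j * (2 * 1) + k * (2 * -1) by omega,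
          charZ_add, charZ_add, charZ_pow, charZ_pow]
        ring
      have hper : ∀ (a b : ℕ) (c : ℤ), Function.Periodic (fun ω =>
          charZ (-c) ω * (charSum 1 n ω ^ a * charSum (-1) n ω ^ b)) 1 := fun a b c ω => by
        simp only [charZ_add_one, charSum_add_one]
      simp only [hω]
      rw [intervalIntegral.integral_finsetSum fun j _ =>
        Continuous.intervalIntegrable (by fun_prop) _ _]
      push_cast
      refine Finset.sum_congr rfl fun j _ => ?_
      rw [intervalIntegral.integral_finsetSum fun k _ =>
        Continuous.intervalIntegrable (by fun_prop) _ _]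
      refine Finset.sum_congr rfl fun k _ => ?_
      rw [intervalIntegral.integral_const_mul, ← ih]
      congr 1
      simpa using integral_comp_natCast_mul_of_periodic (by fun_prop)
        (hper (a - j) (b - k) (c / 2 - j + k)) two_ne_zero
    · rw [Nat.cast_zero]
      -- All frequencies in `charSum` are even, so a half-period shift only changes the sign of the
      -- odd character.
      refine integral_eq_zero_of_antiperiodic_half fun ω => ?_
      simp only [charSum_add_half]
      rw [show -c = 2 * (-c / 2) + 1 by omega, charZ_odd_add_half, neg_mul]

theorem integral_unifMeasure {E : Type*} [NormedAddCommGroup E] [NormedSpace ℝ E] (f : ℝ → E) :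
    ∫ ω, f ω ∂unifMeasure = ∫ ω in (0 : ℝ)..1, f ω := by
  rw [unifMeasure, integral_Icc_eq_integral_Ioc, intervalIntegral.integral_of_le zero_le_one]

theorem two_mul_lacunarySum_shiftedPow (n : ℕ) (ω : ℝ) :
    ((2 * lacunarySum shiftedPow n ω : ℝ) : ℂ) =
      charZ 1 ω * charSum 1 n ω + charZ (-1) ω * charSum (-1) n ω := by
  simp only [lacunarySum, charSum, Finset.mul_sum, ← Finset.sum_add_distrib, ← charZ_add]
  push_cast
  refine Finset.sum_congr rfl fun k _ => ?_
  have h := charZ_add_charZ_neg (shiftedPow k) ω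
  push_cast at h
  rw [← h]
  congr 2 <;> simp only [shiftedPow] <;> push_cast <;> ring

theorem integral_lacunarySum_shiftedPow_pow (p n : ℕ) :
    ∫ ω, lacunarySum shiftedPow n ω ^ p ∂unifMeasure = signedPowMoment p n / 2 ^ p := by
  rw [eq_div_iff (by positivity), integral_unifMeasure, ← intervalIntegral.integral_mul_const]
  simp only [← mul_pow, mul_comm _ (2 : ℝ)]
  rw [← Complex.ofReal_inj, ← intervalIntegral.integral_ofReal]
  have hω : ∀ ω, (((2 * lacunarySum shiftedPow n ω) ^ p : ℝ) : ℂ) =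
      ∑ a ∈ Finset.range (p + 1), (p.choose a : ℂ) *
        (charZ (-((p - a : ℕ) - a)) ω * (charSum 1 n ω ^ a * charSum (-1) n ω ^ (p - a))) := by
    intro ω
    rw [Complex.ofReal_pow, two_mul_lacunarySum_shiftedPow, add_pow]
    refine Finset.sum_congr rfl fun a _ => ?_
    rw [show -(((p - a : ℕ) : ℤ) - a) = a * 1 + (p - a : ℕ) * -1 by ring, charZ_add, mul_pow,
      mul_pow, charZ_pow, charZ_pow]
    ring
  simp only [hω]
  rw [intervalIntegral.integral_finsetSum fun a _ =>
    Continuous.intervalIntegrable (by fun_prop) _ _]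
  simp only [intervalIntegral.integral_const_mul, integral_charZ_mul_charSum_pow]
  simp [signedPowMoment]

/-! ### Cumulants of symmetric variables -/

section Cumulant

variable {Ω : Type*} [MeasurableSpace Ω] {μ : Measure Ω} {X : Ω → ℝ}

theorem cumulant_eq_zero_of_odd (hX : ∀ t, mgf X μ (-t) = mgf X μ t) {m : ℕ} (hm : Odd m) :
    cumulant m X μ = 0 := by
  have h := iteratedDeriv_comp_neg m (cgf X μ) 0
  have hc : (fun t => cgf X μ (-t)) = cgf X μ := funext fun t => by rw [cgf, cgf, hX]
  rw [hc, neg_zero, hm.neg_one_pow, neg_one_smul] at h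
  exact self_eq_neg.1 h

/-- The moment-cumulant recursion. -/
theorem integral_pow_succ_eq_sum_cumulant [IsProbabilityMeasure μ]
    (hX : integrableExpSet X μ = Set.univ) (n : ℕ) :
    ∫ ω, X ω ^ (n + 1) ∂μ =
      ∑ i ∈ Finset.range (n + 1), n.choose i * cumulant (i + 1) X μ * ∫ ω, X ω ^ (n - i) ∂μ := by
  have hmem : ∀ t, t ∈ interior (integrableExpSet X μ) := by simp [hX]
  have hmgf : ∀ k, ∫ ω, X ω ^ k ∂μ = iteratedDeriv k (mgf X μ) 0 := fun k =>
    (iteratedDeriv_mgf_zero (hmem 0) k).symm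
  -- Since `cgf = log mgf`, this holds wherever `mgf` is finite; the recursion is its Leibniz rule
  -- at `0`.
  have hderiv : deriv (mgf X μ) = deriv (cgf X μ) * mgf X μ := by
    ext t
    have hpos : 0 < mgf X μ t := mgf_pos (show t ∈ integrableExpSet X μ by simp [hX])
    rw [Pi.mul_apply, deriv_cgf (hmem t), deriv_mgf (hmem t), div_mul_cancel₀ _ hpos.ne']
  simp only [hmgf, cumulant, iteratedDeriv_succ', hderiv]
  exact iteratedDeriv_mul (analyticAt_cgf (hmem 0)).deriv.contDiffAt
    (analyticAt_mgf (hmem 0)).contDiffAt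

variable [IsProbabilityMeasure μ]

theorem cumulant_two_of_symmetric (hX : integrableExpSet X μ = Set.univ)
    (hs : ∀ t, mgf X μ (-t) = mgf X μ t) : cumulant 2 X μ = ∫ ω, X ω ^ 2 ∂μ := by
  have h1 := cumulant_eq_zero_of_odd hs (show Odd 1 by decide)
  have h := integral_pow_succ_eq_sum_cumulant hX 1
  simp [Finset.sum_range_succ, h1] at h
  exact h.symm

theorem cumulant_four_of_symmetric (hX : integrableExpSet X μ = Set.univ)
    (hs : ∀ t, mgf X μ (-t) = mgf X μ t) :
    cumulant 4 X μ = ∫ ω, X ω ^ 4 ∂μ - 3 * (∫ ω, X ω ^ 2 ∂μ) ^ 2 := by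
  have h1 := cumulant_eq_zero_of_odd hs (show Odd 1 by decide)
  have h3 := cumulant_eq_zero_of_odd hs (show Odd 3 by decide)
  have h := integral_pow_succ_eq_sum_cumulant hX 3
  simp [Finset.sum_range_succ, h1, h3, Nat.choose, cumulant_two_of_symmetric hX hs] at h
  linear_combination -h

theorem cumulant_six_of_symmetric (hX : integrableExpSet X μ = Set.univ)
    (hs : ∀ t, mgf X μ (-t) = mgf X μ t) :
    cumulant 6 X μ = ∫ ω, X ω ^ 6 ∂μ - 15 * (∫ ω, X ω ^ 4 ∂μ) * ∫ ω, X ω ^ 2 ∂μ +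
      30 * (∫ ω, X ω ^ 2 ∂μ) ^ 3 := by
  have h1 := cumulant_eq_zero_of_odd hs (show Odd 1 by decide)
  have h3 := cumulant_eq_zero_of_odd hs (show Odd 3 by decide)
  have h5 := cumulant_eq_zero_of_odd hs (show Odd 5 by decide)
  have h := integral_pow_succ_eq_sum_cumulant hX 5
  simp [Finset.sum_range_succ, h1, h3, h5, Nat.choose, cumulant_two_of_symmetric hX hs,
    cumulant_four_of_symmetric hX hs] at h
  linear_combination -h

end Cumulant

/-! ### Cumulants of the lacunary sum -/

theorem integrableExpSet_lacunarySum (a : ℕ → ℕ) (n : ℕ) :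
    integrableExpSet (lacunarySum a n) unifMeasure = Set.univ :=
  Set.eq_univ_of_forall (lacunarySum_integrable_exp a n)

theorem cos_two_pi_mul_add_one (a : ℕ) (ω : ℝ) :
    Real.cos (2 * Real.pi * a * (ω + 1)) = Real.cos (2 * Real.pi * a * ω) := by
  rw [show 2 * Real.pi * a * (ω + 1) = 2 * Real.pi * a * ω + a * (2 * Real.pi) by ring,
    Real.cos_add_nat_mul_two_pi]

theorem cos_two_pi_odd_mul_add_half {a : ℕ} (ha : Odd a) (ω : ℝ) :
    Real.cos (2 * Real.pi * a * (ω + 1 / 2)) = -Real.cos (2 * Real.pi * a * ω) := by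
  obtain ⟨m, rfl⟩ := ha
  rw [← Real.cos_add_pi, ← Real.cos_add_nat_mul_two_pi (_ + _) m]
  push_cast
  ring_nf

theorem odd_shiftedPow {k : ℕ} (hk : 1 ≤ k) : Odd (shiftedPow k) := by
  rw [shiftedPow]
  exact (even_two.pow_of_ne_zero (by omega)).add_one

theorem mgf_lacunarySum_neg {a : ℕ → ℕ} (ha : ∀ k, 1 ≤ k → Odd (a k)) (n : ℕ) (t : ℝ) :
    mgf (lacunarySum a n) unifMeasure (-t) = mgf (lacunarySum a n) unifMeasure t := by
  have hp : Function.Periodic (fun ω => Real.exp (t * lacunarySum a n ω)) 1 := fun ω => by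
    simp only [lacunarySum, cos_two_pi_mul_add_one]
  have hs : ∀ ω, lacunarySum a n (ω + 1 / 2) = -lacunarySum a n ω := fun ω => by
    rw [lacunarySum, lacunarySum, ← Finset.sum_neg_distrib]
    exact Finset.sum_congr rfl fun k hk =>
      cos_two_pi_odd_mul_add_half (ha k (Finset.mem_Icc.1 hk).1) ω
  have h := intervalIntegral.integral_comp_add_right (a := 0) (b := 1)
    (fun ω => Real.exp (t * lacunarySum a n ω)) (1 / 2)
  rw [zero_add, add_comm (1 : ℝ), hp.intervalIntegral_add_eq (1 / 2) 0, zero_add] at h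
  simp only [mgf, integral_unifMeasure, ← h, hs, neg_mul, mul_neg]

theorem integral_lacunarySum_sq {n : ℕ} (hn : 1 ≤ n) :
    ∫ ω, lacunarySum shiftedPow n ω ^ 2 ∂unifMeasure = n / 2 := by
  have h : (signedPowMoment 2 n : ℝ) = 2 * n := by exact_mod_cast signedPowMoment_two hn
  rw [integral_lacunarySum_shiftedPow_pow, h]
  ring

theorem mgf_lacunarySum_shiftedPow_neg (n : ℕ) (t : ℝ) :
    mgf (lacunarySum shiftedPow n) unifMeasure (-t) =
      mgf (lacunarySum shiftedPow n) unifMeasure t :=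
  mgf_lacunarySum_neg (fun _ => odd_shiftedPow) n t

theorem cumulant_two_lacunarySum {n : ℕ} (hn : 1 ≤ n) :
    cumulant 2 (lacunarySum shiftedPow n) unifMeasure = n / 2 := by
  rw [cumulant_two_of_symmetric (integrableExpSet_lacunarySum _ n)
    (mgf_lacunarySum_shiftedPow_neg n), integral_lacunarySum_sq hn]

theorem cumulant_four_lacunarySum {n : ℕ} (hn : 4 ≤ n) :
    cumulant 4 (lacunarySum shiftedPow n) unifMeasure = (-3 * (n : ℝ) + 28) / 8 := by
  have h : (signedPowMoment 4 n : ℝ) = 12 * n ^ 2 - 6 * n + 56 := by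
    exact_mod_cast signedPowMoment_four hn
  rw [cumulant_four_of_symmetric (integrableExpSet_lacunarySum _ n)
    (mgf_lacunarySum_shiftedPow_neg n), integral_lacunarySum_sq (by omega),
    integral_lacunarySum_shiftedPow_pow, h]
  ring

theorem cumulant_six_lacunarySum {n : ℕ} (hn : 7 ≤ n) :
    cumulant 6 (lacunarySum shiftedPow n) unifMeasure =
      (45 * (n : ℝ) ^ 2 + 380 * (n : ℝ) - 1875) / 16 := by
  have h4 : (signedPowMoment 4 n : ℝ) = 12 * n ^ 2 - 6 * n + 56 := by
    exact_mod_cast signedPowMoment_four (by omega)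
  have h6 : (signedPowMoment 6 n : ℝ) = 120 * n ^ 3 + 3200 * n - 7500 := by
    exact_mod_cast signedPowMoment_six hn
  rw [cumulant_six_of_symmetric (integrableExpSet_lacunarySum _ n)
    (mgf_lacunarySum_shiftedPow_neg n), integral_lacunarySum_sq (by omega),
    integral_lacunarySum_shiftedPow_pow, integral_lacunarySum_shiftedPow_pow, h4, h6]
  ring

/-- A single cosine, the building block of the independent model. -/
theorem cumulant_six_lacunarySum_one :
    cumulant 6 (lacunarySum shiftedPow 1) unifMeasure = 5 / 4 := by
  rw [cumulant_six_of_symmetric (integrableExpSet_lacunarySum _ 1)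
    (mgf_lacunarySum_shiftedPow_neg 1), integral_lacunarySum_sq le_rfl,
    integral_lacunarySum_shiftedPow_pow, integral_lacunarySum_shiftedPow_pow,
    signedPowMoment_four_one, signedPowMoment_six_one]
  norm_num

theorem tendsto_cumulant_six_lacunarySum_div_sq :
    Tendsto (fun n : ℕ => cumulant 6 (lacunarySum shiftedPow n) unifMeasure / (n : ℝ) ^ 2)
      atTop (𝓝 (45 / 16)) := by
  have hinv : Tendsto (fun n : ℕ => (n : ℝ)⁻¹) atTop (𝓝 0) := tendsto_inv_atTop_nhds_zero_nat
  have h : Tendsto (fun n : ℕ => 45 / 16 + 95 / 4 * (n : ℝ)⁻¹ - 1875 / 16 * ((n : ℝ)⁻¹) ^ 2)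
      atTop (𝓝 (45 / 16)) := by
    simpa using ((hinv.const_mul (95 / 4)).const_add (45 / 16)).sub
      ((hinv.pow 2).const_mul (1875 / 16))
  refine h.congr' ?_
  filter_upwards [eventually_ge_atTop 7] with n hn
  have hn0 : (n : ℝ) ≠ 0 := by
    rw [Nat.cast_ne_zero]
    omega
  rw [cumulant_six_lacunarySum hn]
  field_simp
  ring

/-! ### The independent model -/

/-- The law of `cos (2 π a U)` with `U` uniform on `[0, 1]` does not depend on `a ≠ 0`. -/
theorem mgf_cos_two_pi_mul {a : ℕ} (ha : a ≠ 0) (t : ℝ) :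
    mgf (fun ω => Real.cos (2 * Real.pi * a * ω)) unifMeasure t =
      mgf (fun ω => Real.cos (2 * Real.pi * ω)) unifMeasure t := by
  have h := integral_comp_natCast_mul_of_periodic
    (f := fun ω => Real.exp (t * Real.cos (2 * Real.pi * ω))) (by fun_prop)
    (fun ω => by simpa using congrArg (fun x => Real.exp (t * x)) (cos_two_pi_mul_add_one 1 ω)) ha
  simpa only [mgf, integral_unifMeasure, mul_assoc] using h

/-- Independence makes the `cgf` additive, and every summand has the moment generating function of
`lacunarySum shiftedPow 1`. -/
theorem cumulant_six_independentSum {Ω : Type*} [MeasurableSpace Ω] {P : Measure Ω}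
    {U : ℕ → Ω → ℝ} (hU : ∀ k, HasLaw (U k) unifMeasure P) (hind : iIndepFun U P) (n : ℕ) :
    cumulant 6 (independentSum shiftedPow U n) P = 5 / 4 * (n : ℝ) := by
  have hmeas : ∀ k, Measurable fun ω : ℝ => Real.cos (2 * Real.pi * (shiftedPow k : ℝ) * ω) :=
    fun k => by fun_prop
  have hmgf : ∀ k t, mgf (fun ω => Real.cos (2 * Real.pi * (shiftedPow k : ℝ) * U k ω)) P t =
      mgf (lacunarySum shiftedPow 1) unifMeasure t := fun k t => by
    have h1 : mgf (fun ω => Real.cos (2 * Real.pi * (shiftedPow k : ℝ) * U k ω)) P t =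
        mgf (fun ω => Real.cos (2 * Real.pi * (shiftedPow k : ℝ) * ω)) unifMeasure t := by
      rw [← (hU k).map_eq, mgf_map (hU k).aemeasurable (by fun_prop)]
      rfl
    rw [h1, mgf_cos_two_pi_mul (by simp [shiftedPow]), ← mgf_cos_two_pi_mul
      (show shiftedPow 1 ≠ 0 by simp [shiftedPow])]
    congr 1
    ext ω
    simp [lacunarySum]
  have := hind.isProbabilityMeasure
  have hcgf : cgf (independentSum shiftedPow U n) P =
      fun t => (n : ℝ) * cgf (lacunarySum shiftedPow 1) unifMeasure t := by
    ext t
    have h := (hind.comp _ hmeas).cgf_sum₀ (t := t) (s := Finset.Icc 1 n)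
      (fun k => (hmeas k).comp_aemeasurable (hU k).aemeasurable)
      (fun k _ => Integrable.of_bound (C := Real.exp |t|)
        (((hmeas k).comp_aemeasurable (hU k).aemeasurable).const_mul t).exp.aestronglyMeasurable
        (Eventually.of_forall fun ω => by
          rw [Real.norm_eq_abs, Real.abs_exp, Real.exp_le_exp]
          refine (le_abs_self _).trans ?_
          rw [abs_mul]
          exact mul_le_of_le_one_right (abs_nonneg t) (Real.abs_cos_le_one _)))
    have hsum : ∑ k ∈ Finset.Icc 1 n,
        ((fun ω : ℝ => Real.cos (2 * Real.pi * (shiftedPow k : ℝ) * ω)) ∘ U k) =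
        independentSum shiftedPow U n := by
      ext ω
      simp [independentSum]
    rw [← hsum, h]
    simp only [cgf, Function.comp_def, hmgf]
    simp
  rw [cumulant, hcgf, iteratedDeriv_const_mul_field, ← cumulant, cumulant_six_lacunarySum_one]
  ring

theorem theoremB :
    (∀ n : ℕ, 1 ≤ n → ∀ m : ℕ, Odd m →
      cumulant m (lacunarySum shiftedPow n) unifMeasure = 0) ∧
    (∀ n : ℕ, 1 ≤ n →
      cumulant 2 (lacunarySum shiftedPow n) unifMeasure = (n : ℝ) / 2) ∧
    (∀ n : ℕ, 4 ≤ n →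
      cumulant 4 (lacunarySum shiftedPow n) unifMeasure = (-3 * (n : ℝ) + 28) / 8) ∧
    (∀ n : ℕ, 7 ≤ n →
      cumulant 6 (lacunarySum shiftedPow n) unifMeasure
        = (45 * (n : ℝ) ^ 2 + 380 * (n : ℝ) - 1875) / 16) ∧
    Tendsto (fun n : ℕ => cumulant 6 (lacunarySum shiftedPow n) unifMeasure / (n : ℝ) ^ 2)
      atTop (𝓝 (45 / 16)) ∧
    (∀ (Ω : Type*) [MeasurableSpace Ω] (P : Measure Ω) [IsProbabilityMeasure P]
      (U : ℕ → Ω → ℝ), (∀ k, HasLaw (U k) unifMeasure P) → iIndepFun U P →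
      ∀ n : ℕ, cumulant 6 (independentSum shiftedPow U n) P = 5 / 4 * (n : ℝ)) := by
  refine ⟨fun n _ m hm => cumulant_eq_zero_of_odd (mgf_lacunarySum_shiftedPow_neg n) hm,
    fun n => cumulant_two_lacunarySum, fun n => cumulant_four_lacunarySum,
    fun n => cumulant_six_lacunarySum, tendsto_cumulant_six_lacunarySum_div_sq, ?_⟩
  intro Ω _ P _ U hU hind n
  exact cumulant_six_independentSum hU hind n
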